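/- Let $\ell:\mathbb{R}\to[0,\infty)$ be measurable (a likelihood $f\mapsto p(y\mid f)$ for a fixed observation $y$), let $\mu\in\mathbb{R}$ and $v>0$, and suppose that $Z=\int \ell(f)\,\mathcal N(f\mid\mu,v)\,\mathrm{d}f$ satisfies $0<Z<\infty$. Let $\widetilde q$ be the univariate tilted distribution with density $Z^{-1}\ell(f)\,\mathcal N(f\mid\mu,v)$, and suppose that it has finite second moment; write $\mu_{\widetilde q}$ and $\sigma^2_{\widetilde q}$ for its mean and variance. "Gaussian" means $\mathcal N(m,s)$ with mean $m\in\mathbb{R}$ and variance $s>0$. For probability measures $\xi,\nu$ on $\mathbb{R}$ let $W_2^2(\xi,\nu)=\inf_\pi\int|x-z|^2\,\mathrm{d}\pi(x,z)$, where $\pi$ runs over all measures on $\mathbb{R}^2$ with marginals $\xi$ and $\nu$. Then the following hold. 1. There is a unique Gaussian $\mathcal N(\mu_{QP},\sigma^2_{QP})$ that minimises $W_2(\widetilde q,\cdot)$ over all Gaussians. It satisfies $\sigma^2_{QP}\le\sigma^2_{\widetilde q}$ and $W_2^2\big(\widetilde q,\mathcal N(\mu_{QP},\sigma^2_{QP})\big)=\sigma^2_{\widetilde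 q}-\sigma^2_{QP}$, and $\sigma^2_{QP}=\sigma^2_{\widetilde q}$ if and only if $\widetilde q$ is Gaussian. 2. If $\mathrm{KL}(\widetilde q\,\|\,\mathcal N)<\infty$ for some Gaussian $\mathcal N$, then there is a unique Gaussian $\mathcal N(\mu_{EP},\sigma^2_{EP})$ that minimises $\mathrm{KL}(\widetilde q\,\|\,\cdot)$ over all Gaussians, and $\mu_{EP}=\mu_{\widetilde q}$, $\sigma^2_{EP}=\sigma^2_{\widetilde q}$. Hence $\sigma^2_{QP}\le\sigma^2_{EP}$ and $W_2^2\big(\widetilde q,\mathcal N(\mu_{QP},\sigma^2_{QP})\big)=\sigma^2_{EP}-\sigma^2_{QP}$, and $\sigma^2_{QP}=\sigma^2_{EP}$ if and only if $\widetilde q$ is Gaussian. -/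

import Mathlib

open MeasureTheory ProbabilityTheory InformationTheory
open scoped NNReal ENNReal

noncomputable section

/-- The univariate tilted distribution with Gaussian cavity distribution `N(μ, v)` and likelihood
`ℓ = p(y | ·)`: the measure with density `ℓ f * N(f | μ, v) / Z`, where
`Z = ∫ ℓ f * N(f | μ, v) df`. -/
def tiltedDistribution (μ : ℝ) (v : ℝ≥0) (ℓ : ℝ → ℝ) : Measure ℝ :=
  (gaussianReal μ v).withDensity
    (fun f => ENNReal.ofReal (ℓ f / ∫ g, ℓ g ∂(gaussianReal μ v)))

/-- The couplings of `ξ` and `ν`: the measures on the product with marginals `ξ` and `ν`. -/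
def couplings (ξ ν : Measure ℝ) : Set (Measure (ℝ × ℝ)) :=
  {π | π.map Prod.fst = ξ ∧ π.map Prod.snd = ν}

/-- The squared `L₂` Wasserstein distance `W₂²(ξ, ν)` of two distributions on the real line. -/
def wasserstein2Sq (ξ ν : Measure ℝ) : ℝ≥0∞ :=
  ⨅ π ∈ couplings ξ ν, ∫⁻ z, ENNReal.ofReal (|z.1 - z.2| ^ 2) ∂π

/-- `N(m, s)` (mean `m`, variance `s > 0`) is a projection of `q` onto the Gaussian family with
respect to the divergence `D`: it minimises `D q ·` over all Gaussians, with finite minimum (if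
`D q ·` is identically infinite there is no projection). -/
def IsGaussianProjection (D : Measure ℝ → Measure ℝ → ℝ≥0∞) (q : Measure ℝ)
    (m : ℝ) (s : ℝ≥0) : Prop :=
  0 < s ∧ D q (gaussianReal m s) ≠ ∞ ∧
    ∀ (m' : ℝ) (s' : ℝ≥0), 0 < s' → D q (gaussianReal m s) ≤ D q (gaussianReal m' s')

/-- The projection used by quantile propagation: minimal `L₂` Wasserstein distance. -/
def IsQPProjection (q : Measure ℝ) (m : ℝ) (s : ℝ≥0) : Prop :=
  IsGaussianProjection wasserstein2Sq q m s

/-- The projection used by expectation propagation: minimal `KL(q ‖ N(m, s))`. -/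
def IsEPProjection (q : Measure ℝ) (m : ℝ) (s : ℝ≥0) : Prop :=
  IsGaussianProjection (fun q p => klDiv q p) q m s

/-- `q` is a (non-degenerate) Gaussian distribution on the real line. -/
def IsGaussianLaw (q : Measure ℝ) : Prop :=
  ∃ (m : ℝ) (s : ℝ≥0), 0 < s ∧ q = gaussianReal m s

end

/-! Write `V` for the variance of `q` and `c` for the supremum of `𝔼[X Z]` over couplings of `X ∼ q`
with a standard Gaussian `Z`. Couplings of `q` with `N(m, s)` correspond to couplings with `N(0, 1)`
through `Y = m + √s Z`, and expanding the square gives `W₂² = (𝔼X - m)² + (√s - c)² + (V - c²)`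
(`wasserstein2Sq_gaussianReal`). No optimal coupling or quantile function is needed. The minimiser
is thus `m = 𝔼X`, `s = c²`, with value `V - c²`. It is an admissible Gaussian because `c > 0`, which
follows from a coupling with positive covariance (`exists_mem_couplings_integral_mul_gt`). If `s =
V` the distance vanishes, so `q` is Gaussian (`eq_of_wasserstein2Sq_eq_zero`).

For KL, the Gaussian log-density is quadratic, so `KL(q ‖ N(m, s))` is a constant plus an explicit
function of `m`, `s` and the first two moments of `q`; `log x ≤ x - 1`, with equality only at `1`,
gives moment matching (`isEPProjection_iff`). -/

/-! ### Couplings, and separation of laws by `W₂` -/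

section Couplings

variable {ξ ν : Measure ℝ} {π : Measure (ℝ × ℝ)}

lemma isProbabilityMeasure_of_mem_couplings [IsProbabilityMeasure ξ] (hπ : π ∈ couplings ξ ν) :
    IsProbabilityMeasure π := by
  have h : IsProbabilityMeasure (π.map Prod.fst) := hπ.1 ▸ inferInstance
  exact (Measure.isProbabilityMeasure_map_iff measurable_fst.aemeasurable).1 h

lemma memLp_fst_of_mem_couplings (hπ : π ∈ couplings ξ ν) (hξ : MemLp id 2 ξ) :
    MemLp Prod.fst 2 π :=
  MemLp.comp_of_map (g := id) (hπ.1 ▸ hξ) measurable_fst.aemeasurable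

lemma memLp_snd_of_mem_couplings (hπ : π ∈ couplings ξ ν) (hν : MemLp id 2 ν) :
    MemLp Prod.snd 2 π :=
  MemLp.comp_of_map (g := id) (hπ.2 ▸ hν) measurable_snd.aemeasurable

lemma integral_fst_of_mem_couplings {E : Type*} [NormedAddCommGroup E] [NormedSpace ℝ E]
    (hπ : π ∈ couplings ξ ν) {f : ℝ → E} (hf : StronglyMeasurable f) :
    ∫ z, f z.1 ∂π = ∫ x, f x ∂ξ := by
  rw [← hπ.1, integral_map measurable_fst.aemeasurable hf.aestronglyMeasurable]

lemma integral_snd_of_mem_couplings {E : Type*} [NormedAddCommGroup E] [NormedSpace ℝ E]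
    (hπ : π ∈ couplings ξ ν) {f : ℝ → E} (hf : StronglyMeasurable f) :
    ∫ z, f z.2 ∂π = ∫ x, f x ∂ν := by
  rw [← hπ.2, integral_map measurable_snd.aemeasurable hf.aestronglyMeasurable]

lemma wasserstein2Sq_self (ξ : Measure ℝ) : wasserstein2Sq ξ ξ = 0 := by
  refine le_antisymm ?_ bot_le
  have hd : Measurable fun x : ℝ => (x, x) := by fun_prop
  have hmem : ξ.map (fun x => (x, x)) ∈ couplings ξ ξ := by
    constructor
    · rw [Measure.map_map measurable_fst hd]; exact Measure.map_id
    · rw [Measure.map_map measurable_snd hd]; exact Measure.map_id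
  refine (iInf₂_le _ hmem).trans ?_
  rw [lintegral_map (by fun_prop) hd]
  simp

/-- The map `x ↦ exp(itx)` is `|t|`-Lipschitz, so the difference is at most `|t| 𝔼|X - Y|`, then
Jensen. -/
lemma norm_charFun_sub_le_of_mem_couplings [IsProbabilityMeasure ξ] (hπ : π ∈ couplings ξ ν)
    (hξ : MemLp id 2 ξ) (hν : MemLp id 2 ν) (t : ℝ) :
    ‖charFun ξ t - charFun ν t‖ ≤ |t| * √(∫ z, (z.1 - z.2) ^ 2 ∂π) := by
  have := isProbabilityMeasure_of_mem_couplings hπ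
  have h1 := memLp_fst_of_mem_couplings hπ hξ
  have h2 := memLp_snd_of_mem_couplings hπ hν
  have h12 : MemLp (fun z : ℝ × ℝ => |z.1 - z.2|) 2 π := (h1.sub h2).abs
  have hm : StronglyMeasurable fun x : ℝ => Complex.exp (t * x * Complex.I) := by
    exact Measurable.stronglyMeasurable (by fun_prop)
  have hb : ∀ x : ℝ, ‖Complex.exp (t * x * Complex.I)‖ ≤ 1 := fun x => by
    rw [← Complex.ofReal_mul, Complex.norm_exp_ofReal_mul_I]
  have hi1 : Integrable (fun z : ℝ × ℝ => Complex.exp (t * z.1 * Complex.I)) π :=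
    Integrable.of_bound (by fun_prop) 1 (ae_of_all _ fun z => hb z.1)
  have hi2 : Integrable (fun z : ℝ × ℝ => Complex.exp (t * z.2 * Complex.I)) π :=
    Integrable.of_bound (by fun_prop) 1 (ae_of_all _ fun z => hb z.2)
  -- Jensen's inequality, as nonnegativity of the variance of `|X - Y|`.
  have hsq : (∫ z, |z.1 - z.2| ∂π) ^ 2 ≤ ∫ z, (z.1 - z.2) ^ 2 ∂π := by
    have h := variance_eq_sub h12
    have h0 := variance_nonneg (fun z : ℝ × ℝ => |z.1 - z.2|) π
    simp only [Pi.pow_apply, sq_abs] at h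
    linarith
  calc ‖charFun ξ t - charFun ν t‖
      = ‖∫ z, (Complex.exp (t * z.1 * Complex.I) - Complex.exp (t * z.2 * Complex.I)) ∂π‖ := by
        rw [integral_sub hi1 hi2, integral_fst_of_mem_couplings hπ hm,
          integral_snd_of_mem_couplings hπ hm, charFun_apply_real, charFun_apply_real]
    _ ≤ ∫ z, |t| * |z.1 - z.2| ∂π := by
        refine norm_integral_le_of_norm_le ((h12.integrable one_le_two).const_mul _)
          (ae_of_all _ fun z => ?_)
        have he : Complex.exp (t * z.1 * Complex.I) - Complex.exp (t * z.2 * Complex.I)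
            = Complex.exp (t * z.2 * Complex.I)
              * (Complex.exp (Complex.I * (t * (z.1 - z.2) : ℝ)) - 1) := by
          rw [mul_sub, ← Complex.exp_add, mul_one]
          congr 2
          push_cast
          ring
        rw [he, norm_mul]
        calc _ ≤ 1 * ‖t * (z.1 - z.2)‖ :=
              mul_le_mul (hb _) Real.norm_exp_I_mul_ofReal_sub_one_le (norm_nonneg _) zero_le_one
          _ = |t| * |z.1 - z.2| := by rw [one_mul, Real.norm_eq_abs, abs_mul]
    _ ≤ |t| * √(∫ z, (z.1 - z.2) ^ 2 ∂π) := by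
        rw [integral_const_mul]
        exact mul_le_mul_of_nonneg_left (Real.le_sqrt_of_sq_le hsq) (abs_nonneg t)

/-- The infimum is not known to be attained, so near-optimal couplings are used to make the
characteristic functions arbitrarily close. -/
lemma eq_of_wasserstein2Sq_eq_zero [IsProbabilityMeasure ξ] [IsProbabilityMeasure ν]
    (hξ : MemLp id 2 ξ) (hν : MemLp id 2 ν) (h : wasserstein2Sq ξ ν = 0) : ξ = ν := by
  refine Measure.ext_of_charFun (funext fun t => ?_)
  rw [← sub_eq_zero, ← norm_le_zero_iff]
  refine le_of_forall_pos_le_add fun ε hε => ?_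
  -- Chosen so that `|t| √δ ≤ ε`; the `+ 1` covers `t = 0`.
  set δ : ℝ := (ε / (|t| + 1)) ^ 2
  have hδ : 0 < δ := by positivity
  have hlt : wasserstein2Sq ξ ν < ENNReal.ofReal δ := by rw [h]; simpa using hδ
  simp only [wasserstein2Sq, iInf_lt_iff] at hlt
  obtain ⟨π, hπ, hlt⟩ := hlt
  have hint : ∫ z, (z.1 - z.2) ^ 2 ∂π ≤ δ := by
    have hi : Integrable (fun z : ℝ × ℝ => (z.1 - z.2) ^ 2) π :=
      ((memLp_fst_of_mem_couplings hπ hξ).sub (memLp_snd_of_mem_couplings hπ hν)).integrable_sq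
    simp only [sq_abs] at hlt
    rw [← ofReal_integral_eq_lintegral_ofReal hi (ae_of_all _ fun z => sq_nonneg _)] at hlt
    exact (ENNReal.ofReal_lt_ofReal_iff hδ).1 hlt |>.le
  calc _ ≤ |t| * √(∫ z, (z.1 - z.2) ^ 2 ∂π) := norm_charFun_sub_le_of_mem_couplings hπ hξ hν t
    _ ≤ |t| * √δ := by gcongr
    _ = |t| / (|t| + 1) * ε := by rw [Real.sqrt_sq (by positivity)]; ring
    _ ≤ 1 * ε := by
        gcongr
        rw [div_le_one (by positivity)]
        linarith
    _ = 0 + ε := by ring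

end Couplings

/-! ### A coupling with positive covariance -/

section PositiveCorrelation

variable {ρ τ : Measure ℝ}

/-- A square-integrable non-degenerate law on the line is positively correlated with some bounded
centred function. -/
lemma exists_bounded_centred_integral_mul_pos [IsProbabilityMeasure ρ] (hρ : MemLp id 2 ρ)
    (hvar : 0 < variance id ρ) :
    ∃ f : ℝ → ℝ, Measurable f ∧ (∀ x, |f x| ≤ 1) ∧ ∫ x, f x ∂ρ = 0 ∧
      0 < ∫ x, f x * x ∂ρ := by
  set m := ∫ x, x ∂ρ
  -- The sign of `x - m`; centring it and halving keeps the bound `1`.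
  set σ : ℝ → ℝ := fun x => if m < x then 1 else -1
  have hσm : Measurable σ := Measurable.ite measurableSet_Ioi measurable_const measurable_const
  have hσ1 : ∀ x, |σ x| ≤ 1 := fun x => by
    by_cases h : m < x <;> simp [σ, h]
  have hσi : Integrable σ ρ :=
    Integrable.of_bound hσm.aestronglyMeasurable 1 (ae_of_all _ hσ1)
  have hid : Integrable (fun x : ℝ => x) ρ := hρ.integrable one_le_two
  have hcen : Integrable (fun x : ℝ => x - m) ρ := hid.sub (integrable_const m)
  set e := ∫ x, σ x ∂ρ
  have he : |e| ≤ 1 := by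
    have h := norm_integral_le_of_norm_le_const (μ := ρ) (f := σ) (C := 1) (ae_of_all _ hσ1)
    simpa using h
  have hcen0 : ∫ x, (x - m) ∂ρ = 0 := by
    rw [integral_sub hid (integrable_const m)]; simp [m]
  have habs : 0 < ∫ x, |x - m| ∂ρ := by
    refine lt_of_le_of_ne (integral_nonneg fun x => abs_nonneg _) fun h => hvar.ne' ?_
    have h0 := (integral_eq_zero_iff_of_nonneg (fun x => abs_nonneg (x - m)) hcen.abs).1 h.symm
    rw [variance_eq_integral aemeasurable_id]
    refine integral_eq_zero_of_ae ?_
    filter_upwards [h0] with x hx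
    have : x - m = 0 := abs_eq_zero.1 hx
    simpa [m] using this
  refine ⟨fun x => (σ x - e) / 2, by fun_prop, fun x => ?_, ?_, ?_⟩
  · have h1 := abs_le.1 (hσ1 x)
    have h2 := abs_le.1 he
    exact abs_le.2 ⟨by linarith [h1.1, h2.2], by linarith [h1.2, h2.1]⟩
  · rw [integral_div, integral_sub hσi (integrable_const e)]
    simp [e]
  · have hσx : Integrable (fun x => σ x * x) ρ :=
      hid.bdd_mul hσm.aestronglyMeasurable (ae_of_all _ hσ1)
    -- Since `σ x * (x - m) = |x - m|`, only `𝔼|X - m| / 2` survives integration.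
    have hrw : ∀ x, (σ x - e) / 2 * x = 2⁻¹ * |x - m| - e / 2 * (x - m) + m * ((σ x - e) / 2) := by
      intro x
      by_cases h : m < x
      · simp only [σ, h, if_true, abs_of_pos (sub_pos.2 h)]; ring
      · simp only [σ, h, if_false, abs_of_nonpos (sub_nonpos.2 (not_lt.1 h))]; ring
    simp_rw [hrw]
    rw [integral_add, integral_sub, integral_const_mul, integral_const_mul, integral_const_mul,
      integral_div, hcen0, integral_sub hσi (integrable_const e)]
    · simpa [e] using habs
    · exact hcen.abs.const_mul _
    · exact hcen.const_mul _
    · exact (hcen.abs.const_mul _).sub (hcen.const_mul _)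
    · exact ((hσi.sub (integrable_const e)).div_const 2).const_mul m

/-- Two square-integrable non-degenerate laws on the line have a coupling with positive
covariance. -/
lemma exists_mem_couplings_integral_mul_gt [IsProbabilityMeasure ρ] [IsProbabilityMeasure τ]
    (hρ : MemLp id 2 ρ) (hτ : MemLp id 2 τ) (hρv : 0 < variance id ρ) (hτv : 0 < variance id τ) :
    ∃ π ∈ couplings ρ τ, (∫ x, x ∂ρ) * (∫ x, x ∂τ) < ∫ z, z.1 * z.2 ∂π := by
  obtain ⟨f, hfm, hf1, hf0, hfpos⟩ := exists_bounded_centred_integral_mul_pos hρ hρv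
  obtain ⟨g, hgm, hg1, hg0, hgpos⟩ := exists_bounded_centred_integral_mul_pos hτ hτv
  have hnn : ∀ x y, 0 ≤ 1 + f x * g y := fun x y => by
    have h : |f x * g y| ≤ 1 := by
      rw [abs_mul]; exact mul_le_one₀ (hf1 x) (abs_nonneg _) (hg1 y)
    linarith [(abs_le.1 h).1]
  have hfi : Integrable f ρ := Integrable.of_bound hfm.aestronglyMeasurable 1 (ae_of_all _ hf1)
  have hgi : Integrable g τ := Integrable.of_bound hgm.aestronglyMeasurable 1 (ae_of_all _ hg1)
  -- Perturbation of the independent coupling: `|f|, |g| ≤ 1` make the density nonnegative, and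
  -- centring preserves both marginals.
  set h : ℝ × ℝ → ℝ≥0∞ := fun z => ENNReal.ofReal (1 + f z.1 * g z.2)
  have hm : Measurable h := by fun_prop
  have hfst : ∀ x, ∫⁻ y, h (x, y) ∂τ = 1 := fun x => by
    have hi : Integrable (fun y => 1 + f x * g y) τ := (integrable_const 1).add (hgi.const_mul _)
    rw [← ofReal_integral_eq_lintegral_ofReal hi (ae_of_all _ fun y => hnn x y), integral_add (integrable_const 1) (hgi.const_mul _),
      integral_const_mul, hg0]
    simp
  have hsnd : ∀ y, ∫⁻ x, h (x, y) ∂ρ = 1 := fun y => by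
    have hi : Integrable (fun x => 1 + f x * g y) ρ := (integrable_const 1).add (hfi.mul_const _)
    rw [← ofReal_integral_eq_lintegral_ofReal hi (ae_of_all _ fun x => hnn x y), integral_add (integrable_const 1) (hfi.mul_const _),
      integral_mul_const, hf0]
    simp
  refine ⟨(ρ.prod τ).withDensity h, ⟨?_, ?_⟩, ?_⟩
  · ext s hs
    rw [Measure.map_apply measurable_fst hs, withDensity_apply _ (measurable_fst hs),
      ← Set.prod_univ, ← Measure.prod_restrict, Measure.restrict_univ,
      lintegral_prod _ hm.aemeasurable]
    simp [hfst]
  · ext s hs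
    rw [Measure.map_apply measurable_snd hs, withDensity_apply _ (measurable_snd hs),
      ← Set.univ_prod, ← Measure.prod_restrict, Measure.restrict_univ,
      lintegral_prod_symm _ hm.aemeasurable]
    simp [hsnd]
  · have hidρ : Integrable (fun x : ℝ => x) ρ := hρ.integrable one_le_two
    have hidτ : Integrable (fun x : ℝ => x) τ := hτ.integrable one_le_two
    rw [integral_withDensity_eq_integral_toReal_smul hm (ae_of_all _ fun _ => ENNReal.ofReal_lt_top)]
    have hrw : ∀ z : ℝ × ℝ, (h z).toReal • (z.1 * z.2)
        = z.1 * z.2 + (f z.1 * z.1) * (g z.2 * z.2) := fun z => by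
      rw [ENNReal.toReal_ofReal (hnn _ _), smul_eq_mul]; ring
    simp_rw [hrw]
    rw [integral_add (hidρ.mul_prod hidτ), integral_prod_mul (fun x => x) (fun x => x),
      integral_prod_mul (fun x => f x * x) (fun x => g x * x)]
    · linarith [mul_pos hfpos hgpos]
    · exact Integrable.mul_prod (hidρ.bdd_mul hfm.aestronglyMeasurable (ae_of_all _ hf1))
        (hidτ.bdd_mul hgm.aestronglyMeasurable (ae_of_all _ hg1))

end PositiveCorrelation

/-! ### The Wasserstein projection -/

section Wasserstein

variable {q : Measure ℝ}

/-- The largest correlation `𝔼[X Z]` over all couplings of `X ∼ q` with a standard Gaussian `Z`. -/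
noncomputable def gaussianCorrelation (q : Measure ℝ) : ℝ :=
  sSup ((fun π : Measure (ℝ × ℝ) => ∫ z, z.1 * z.2 ∂π) '' couplings q (gaussianReal 0 1))

lemma memLp_two_id_gaussianReal (m : ℝ) (s : ℝ≥0) : MemLp id 2 (gaussianReal m s) := by
  simpa using memLp_id_gaussianReal (μ := m) (v := s) 2

lemma integral_affine_cost [IsProbabilityMeasure q] (hq : MemLp id 2 q) {π : Measure (ℝ × ℝ)}
    (hπ : π ∈ couplings q (gaussianReal 0 1)) (m σ : ℝ) :
    ∫ z, (z.1 - (m + σ * z.2)) ^ 2 ∂π = variance id q + (∫ x, x ∂q - m) ^ 2 + σ ^ 2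
      - 2 * σ * ∫ z, z.1 * z.2 ∂π := by
  have := isProbabilityMeasure_of_mem_couplings hπ
  have h1 := memLp_fst_of_mem_couplings hπ hq
  have h2 := memLp_snd_of_mem_couplings hπ (memLp_two_id_gaussianReal 0 1)
  have hi1 : Integrable (fun z : ℝ × ℝ => z.1) π := h1.integrable one_le_two
  have hi2 : Integrable (fun z : ℝ × ℝ => z.2) π := h2.integrable one_le_two
  have hi11 : Integrable (fun z : ℝ × ℝ => z.1 ^ 2) π := h1.integrable_sq
  have hi22 : Integrable (fun z : ℝ × ℝ => z.2 ^ 2) π := h2.integrable_sq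
  have hi12 : Integrable (fun z : ℝ × ℝ => z.1 * z.2) π := h1.integrable_mul h2
  have e1 : ∫ z, z.1 ∂π = ∫ x, x ∂q :=
    integral_fst_of_mem_couplings hπ (f := fun x => x) stronglyMeasurable_id
  have e2 : ∫ z, z.2 ∂π = 0 := by
    rw [integral_snd_of_mem_couplings hπ (f := fun x => x) stronglyMeasurable_id,
      integral_id_gaussianReal]
  have e11 : ∫ z, z.1 ^ 2 ∂π = variance id q + (∫ x, x ∂q) ^ 2 := by
    rw [integral_fst_of_mem_couplings hπ (f := fun x => x ^ 2)
      (Measurable.stronglyMeasurable (by fun_prop)), variance_eq_sub hq]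
    simp
  have e22 : ∫ z, z.2 ^ 2 ∂π = 1 := by
    have h := variance_eq_sub (memLp_two_id_gaussianReal 0 1)
    rw [variance_id_gaussianReal] at h
    rw [integral_snd_of_mem_couplings hπ (f := fun x => x ^ 2)
      (Measurable.stronglyMeasurable (by fun_prop))]
    simpa using h.symm
  have hrw : ∀ z : ℝ × ℝ, (z.1 - (m + σ * z.2)) ^ 2
      = z.1 ^ 2 - 2 * m * z.1 + m ^ 2 + σ ^ 2 * z.2 ^ 2 + 2 * m * σ * z.2
        - 2 * σ * (z.1 * z.2) := fun z => by ring
  simp_rw [hrw]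
  rw [integral_sub (by fun_prop) (by fun_prop), integral_add (by fun_prop) (by fun_prop),
    integral_add (by fun_prop) (by fun_prop), integral_add (by fun_prop) (by fun_prop),
    integral_sub (by fun_prop) (by fun_prop)]
  simp only [integral_const_mul, e1, e2, e11, e22]
  simp
  ring

lemma lintegral_affine_cost [IsProbabilityMeasure q] (hq : MemLp id 2 q) {π : Measure (ℝ × ℝ)}
    (hπ : π ∈ couplings q (gaussianReal 0 1)) (m σ : ℝ) :
    ∫⁻ z, ENNReal.ofReal (|z.1 - (m + σ * z.2)| ^ 2) ∂π
      = ENNReal.ofReal (variance id q + (∫ x, x ∂q - m) ^ 2 + σ ^ 2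
        - 2 * σ * ∫ z, z.1 * z.2 ∂π) := by
  have := isProbabilityMeasure_of_mem_couplings hπ
  have h2 := memLp_snd_of_mem_couplings hπ (memLp_two_id_gaussianReal 0 1)
  have h : MemLp (fun z : ℝ × ℝ => z.1 - (m + σ * z.2)) 2 π :=
    (memLp_fst_of_mem_couplings hπ hq).sub ((memLp_const m).add (h2.const_mul σ))
  simp only [sq_abs]
  rw [← integral_affine_cost hq hπ, ofReal_integral_eq_lintegral_ofReal h.integrable_sq
    (ae_of_all _ fun z => sq_nonneg _)]

/-- The cost with `m = 𝔼X` and `σ = 𝔼[X Z]` is `V - (𝔼[X Z])²`, which is nonnegative. -/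
lemma integral_mul_sq_le_variance [IsProbabilityMeasure q] (hq : MemLp id 2 q)
    {π : Measure (ℝ × ℝ)} (hπ : π ∈ couplings q (gaussianReal 0 1)) :
    (∫ z, z.1 * z.2 ∂π) ^ 2 ≤ variance id q := by
  have h := integral_affine_cost hq hπ (∫ x, x ∂q) (∫ z, z.1 * z.2 ∂π)
  have h0 : 0 ≤ ∫ z, (z.1 - (∫ x, x ∂q + (∫ z, z.1 * z.2 ∂π) * z.2)) ^ 2 ∂π :=
    integral_nonneg fun z => sq_nonneg _
  nlinarith

lemma bddAbove_gaussianCorrelation [IsProbabilityMeasure q] (hq : MemLp id 2 q) :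
    BddAbove ((fun π : Measure (ℝ × ℝ) => ∫ z, z.1 * z.2 ∂π) ''
      couplings q (gaussianReal 0 1)) := by
  refine ⟨√(variance id q), ?_⟩
  rintro _ ⟨π, hπ, rfl⟩
  exact Real.le_sqrt_of_sq_le (integral_mul_sq_le_variance hq hπ)

lemma integral_mul_le_gaussianCorrelation [IsProbabilityMeasure q] (hq : MemLp id 2 q)
    {π : Measure (ℝ × ℝ)} (hπ : π ∈ couplings q (gaussianReal 0 1)) :
    ∫ z, z.1 * z.2 ∂π ≤ gaussianCorrelation q :=
  le_csSup (bddAbove_gaussianCorrelation hq) ⟨π, hπ, rfl⟩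

lemma exists_mem_couplings_integral_mul_pos [IsProbabilityMeasure q] (hq : MemLp id 2 q)
    (hv : 0 < variance id q) :
    ∃ π ∈ couplings q (gaussianReal 0 1), 0 < ∫ z, z.1 * z.2 ∂π := by
  simpa using exists_mem_couplings_integral_mul_gt hq (memLp_two_id_gaussianReal 0 1) hv
    (by rw [variance_id_gaussianReal]; simp)

lemma gaussianCorrelation_pos [IsProbabilityMeasure q] (hq : MemLp id 2 q)
    (hv : 0 < variance id q) : 0 < gaussianCorrelation q := by
  obtain ⟨π, hπ, h⟩ := exists_mem_couplings_integral_mul_pos hq hv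
  exact h.trans_le (integral_mul_le_gaussianCorrelation hq hπ)

lemma gaussianCorrelation_sq_le_variance [IsProbabilityMeasure q] (hq : MemLp id 2 q)
    (hv : 0 < variance id q) : gaussianCorrelation q ^ 2 ≤ variance id q := by
  obtain ⟨π, hπ, -⟩ := exists_mem_couplings_integral_mul_pos hq hv
  rw [← Real.le_sqrt' (gaussianCorrelation_pos hq hv)]
  refine csSup_le ⟨_, π, hπ, rfl⟩ ?_
  rintro _ ⟨π, hπ, rfl⟩
  exact Real.le_sqrt_of_sq_le (integral_mul_sq_le_variance hq hπ)

lemma map_affine_mem_couplings {π : Measure (ℝ × ℝ)} (hπ : π ∈ couplings q (gaussianReal 0 1))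
    (m : ℝ) (s : ℝ≥0) :
    π.map (fun z => (z.1, m + √s * z.2)) ∈ couplings q (gaussianReal m s) := by
  have hm : Measurable fun z : ℝ × ℝ => (z.1, m + √s * z.2) := by fun_prop
  refine ⟨?_, ?_⟩
  · rw [Measure.map_map measurable_fst hm]
    exact hπ.1
  · rw [Measure.map_map measurable_snd hm]
    have h : (Prod.snd ∘ fun z : ℝ × ℝ => (z.1, m + √s * z.2))
        = (m + ·) ∘ (√s * ·) ∘ Prod.snd := rfl
    rw [h, ← Measure.map_map (by fun_prop) (by fun_prop),
      ← Measure.map_map (by fun_prop) (by fun_prop), hπ.2, gaussianReal_map_const_mul,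
      gaussianReal_map_const_add]
    congr 1
    · simp
    · ext
      simp

lemma map_standardize_mem_couplings {π : Measure (ℝ × ℝ)} {m : ℝ} {s : ℝ≥0}
    (hπ : π ∈ couplings q (gaussianReal m s)) (hs : 0 < s) :
    π.map (fun z => (z.1, (√s)⁻¹ * (z.2 - m))) ∈ couplings q (gaussianReal 0 1) := by
  have hm : Measurable fun z : ℝ × ℝ => (z.1, (√s)⁻¹ * (z.2 - m)) := by fun_prop
  refine ⟨?_, ?_⟩
  · rw [Measure.map_map measurable_fst hm]
    exact hπ.1
  · rw [Measure.map_map measurable_snd hm]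
    have h : (Prod.snd ∘ fun z : ℝ × ℝ => (z.1, (√s)⁻¹ * (z.2 - m)))
        = ((√s)⁻¹ * ·) ∘ (· - m) ∘ Prod.snd := rfl
    rw [h, ← Measure.map_map (by fun_prop) (by fun_prop),
      ← Measure.map_map (by fun_prop) (by fun_prop), hπ.2, gaussianReal_map_sub_const,
      gaussianReal_map_const_mul]
    congr 1
    · simp
    · ext
      simp [hs.ne']

/-- The squared Wasserstein distance to a Gaussian, as a function of its mean and variance. -/
lemma wasserstein2Sq_gaussianReal [IsProbabilityMeasure q] (hq : MemLp id 2 q)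
    (hv : 0 < variance id q) (m : ℝ) {s : ℝ≥0} (hs : 0 < s) :
    wasserstein2Sq q (gaussianReal m s) = ENNReal.ofReal ((∫ x, x ∂q - m) ^ 2
      + (√s - gaussianCorrelation q) ^ 2 + (variance id q - gaussianCorrelation q ^ 2)) := by
  set c := gaussianCorrelation q
  have hσ : 0 < √(s : ℝ) := Real.sqrt_pos.2 (by exact_mod_cast hs)
  set K := variance id q + (∫ x, x ∂q - m) ^ 2 + √(s : ℝ) ^ 2
  have hK : (∫ x, x ∂q - m) ^ 2 + (√s - c) ^ 2 + (variance id q - c ^ 2) = K - 2 * √s * c := by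
    simp only [K]; ring
  have hupper : ∀ π ∈ couplings q (gaussianReal 0 1), wasserstein2Sq q (gaussianReal m s)
      ≤ ENNReal.ofReal (K - 2 * √s * ∫ z, z.1 * z.2 ∂π) := fun π hπ => by
    refine (iInf₂_le _ (map_affine_mem_couplings hπ m s)).trans ?_
    rw [lintegral_map (by fun_prop) (by fun_prop), lintegral_affine_cost hq hπ]
  obtain ⟨π₀, hπ₀, -⟩ := exists_mem_couplings_integral_mul_pos hq hv
  have hfin : wasserstein2Sq q (gaussianReal m s) ≠ ∞ :=
    ne_top_of_le_ne_top ENNReal.ofReal_ne_top (hupper π₀ hπ₀)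
  rw [hK]
  refine le_antisymm ?_ (le_iInf₂ fun π hπ => ?_)
  · rw [← ENNReal.ofReal_toReal hfin]
    refine ENNReal.ofReal_le_ofReal ?_
    -- Each coupling bounds its own `𝔼[X Z]` by this quotient, so the supremum obeys the same bound
    -- without being attained.
    have hc : c ≤ (K - (wasserstein2Sq q (gaussianReal m s)).toReal) / (2 * √s) := by
      refine csSup_le ⟨_, π₀, hπ₀, rfl⟩ ?_
      rintro _ ⟨π, hπ, rfl⟩
      have hnn : 0 ≤ K - 2 * √s * ∫ z, z.1 * z.2 ∂π := by
        rw [← integral_affine_cost hq hπ]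
        exact integral_nonneg fun z => sq_nonneg _
      have h := ENNReal.toReal_le_of_le_ofReal hnn (hupper π hπ)
      rw [le_div_iff₀ (by positivity)]
      simp only
      linarith
    rw [le_div_iff₀ (by positivity)] at hc
    linarith
  -- Standardising the second coordinate turns any coupling into one with `N(0, 1)`, at the same
  -- cost.
  · have hπ' := map_standardize_mem_couplings hπ hs
    have h := lintegral_affine_cost hq hπ' m √s
    rw [lintegral_map (by fun_prop) (by fun_prop)] at h
    have hz : ∀ z : ℝ × ℝ, m + √(s : ℝ) * ((√s)⁻¹ * (z.2 - m)) = z.2 := fun z => by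
      field_simp; ring
    simp only [hz] at h
    rw [h]
    refine ENNReal.ofReal_le_ofReal ?_
    have hle := integral_mul_le_gaussianCorrelation hq hπ'
    gcongr

/-- The Wasserstein projection has the mean of `q` and standard deviation
`gaussianCorrelation q`. -/
lemma isQPProjection_iff [IsProbabilityMeasure q] (hq : MemLp id 2 q) (hv : 0 < variance id q)
    (m : ℝ) (s : ℝ≥0) :
    IsQPProjection q m s ↔ m = ∫ x, x ∂q ∧ (s : ℝ) = gaussianCorrelation q ^ 2 := by
  have hc := gaussianCorrelation_pos hq hv
  have hcV := gaussianCorrelation_sq_le_variance hq hv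
  have hW := fun (m : ℝ) (s : ℝ≥0) (hs : 0 < s) => wasserstein2Sq_gaussianReal hq hv m hs
  generalize gaussianCorrelation q = c at hc hcV hW ⊢
  constructor
  · rintro ⟨hs, -, hmin⟩
    have hs₀ : 0 < Real.toNNReal (c ^ 2) := Real.toNNReal_pos.2 (by positivity)
    have h := hmin (∫ x, x ∂q) _ hs₀
    rw [hW m s hs, hW _ _ hs₀,
      Real.coe_toNNReal _ (sq_nonneg c), Real.sqrt_sq hc.le,
      ENNReal.ofReal_le_ofReal_iff (by simpa using hcV)] at h
    have h1 := sq_nonneg (∫ x, x ∂q - m)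
    have h2 := sq_nonneg (√s - c)
    simp only [sub_self] at h
    have h3 : (∫ x, x ∂q - m) ^ 2 = 0 := by linarith
    have h4 : (√s - c) ^ 2 = 0 := by linarith
    refine ⟨(sub_eq_zero.1 (pow_eq_zero_iff two_ne_zero |>.1 h3)).symm, ?_⟩
    rw [← sub_eq_zero.1 (pow_eq_zero_iff two_ne_zero |>.1 h4), Real.sq_sqrt (NNReal.coe_nonneg s)]
  · rintro ⟨rfl, hs⟩
    have hs₀ : 0 < s := by
      rw [← NNReal.coe_pos, hs]; positivity
    refine ⟨hs₀, ?_, fun m' s' hs' => ?_⟩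
    · rw [hW _ _ hs₀]
      exact ENNReal.ofReal_ne_top
    · rw [hW _ _ hs₀, hW _ _ hs', hs,
        Real.sqrt_sq hc.le]
      refine ENNReal.ofReal_le_ofReal ?_
      have h1 := sq_nonneg (∫ x, x ∂q - m')
      have h2 := sq_nonneg (√s' - c)
      simp only [sub_self]
      linarith

lemma wasserstein2Sq_of_isQPProjection [IsProbabilityMeasure q] (hq : MemLp id 2 q)
    (hv : 0 < variance id q) {m : ℝ} {s : ℝ≥0} (h : IsQPProjection q m s) :
    wasserstein2Sq q (gaussianReal m s) = ENNReal.ofReal (variance id q - s) := by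
  obtain ⟨rfl, hs⟩ := (isQPProjection_iff hq hv m s).1 h
  rw [wasserstein2Sq_gaussianReal hq hv _ h.1, hs, Real.sqrt_sq (gaussianCorrelation_pos hq hv).le]
  simp

lemma isQPProjection_variance_eq_iff [IsProbabilityMeasure q] (hq : MemLp id 2 q)
    (hv : 0 < variance id q) {m : ℝ} {s : ℝ≥0} (h : IsQPProjection q m s) :
    (s : ℝ) = variance id q ↔ IsGaussianLaw q := by
  have hW := wasserstein2Sq_of_isQPProjection hq hv h
  constructor
  · intro hs
    refine ⟨m, s, h.1, eq_of_wasserstein2Sq_eq_zero hq (memLp_two_id_gaussianReal m s) ?_⟩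
    rw [hW, hs]
    simp
  · rintro ⟨m₀, s₀, hs₀, hq₀⟩
    -- `q` itself competes at distance `0`, so the minimum `V - s` truncates to `0` and `V ≤ s`.
    have h0 := h.2.2 m₀ s₀ hs₀
    rw [← hq₀, wasserstein2Sq_self, hW, nonpos_iff_eq_zero, ENNReal.ofReal_eq_zero] at h0
    have hle := gaussianCorrelation_sq_le_variance hq hv
    rw [← ((isQPProjection_iff hq hv m s).1 h).2] at hle
    linarith

end Wasserstein

/-! ### The Kullback–Leibler projection -/

section KullbackLeibler

variable {q : Measure ℝ}

lemma log_gaussianPDFReal (m : ℝ) {s : ℝ≥0} (hs : 0 < s) (x : ℝ) :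
    Real.log (gaussianPDFReal m s x)
      = -(Real.log (2 * Real.pi) + Real.log s) / 2 - (x - m) ^ 2 / (2 * s) := by
  have hs' : (0 : ℝ) < s := by exact_mod_cast hs
  rw [gaussianPDFReal, Real.log_mul (by positivity) (Real.exp_ne_zero _), Real.log_exp,
    Real.log_inv, Real.log_sqrt (by positivity), Real.log_mul (by positivity) hs'.ne']
  ring

lemma llr_gaussianReal_ae_eq [SigmaFinite q] (hq : q ≪ volume) (m : ℝ) {s : ℝ≥0} (hs : 0 < s) :
    llr q (gaussianReal m s)
      =ᵐ[q] fun x => llr q volume x - Real.log (gaussianPDFReal m s x) := by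
  have h := Measure.rnDeriv_withDensity_right q volume
    (measurable_gaussianPDF m s).aemeasurable
    (ae_of_all _ fun x => (gaussianPDF_pos m hs.ne' x).ne')
    (ae_of_all _ fun x => gaussianPDF_ne_top)
  rw [← gaussianReal_of_var_ne_zero m hs.ne'] at h
  filter_upwards [hq.ae_le h, Measure.rnDeriv_pos hq, hq.ae_le (Measure.rnDeriv_lt_top q volume)]
    with x hx h0 htop
  have hpos := ENNReal.toReal_pos h0.ne' htop.ne
  have hg := gaussianPDFReal_pos m s x hs.ne'
  rw [llr, llr, hx, ENNReal.toReal_mul, ENNReal.toReal_inv, toReal_gaussianPDF,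
    Real.log_mul (inv_pos.2 hg).ne' hpos.ne', Real.log_inv]
  ring

lemma integrable_log_gaussianPDFReal [IsProbabilityMeasure q] (hq : MemLp id 2 q)
    (m : ℝ) {s : ℝ≥0} (hs : 0 < s) :
    Integrable (fun x => Real.log (gaussianPDFReal m s x)) q := by
  have h : Integrable (fun x => (x - m) ^ 2) q := (hq.sub (memLp_const m)).integrable_sq
  simp_rw [log_gaussianPDFReal m hs]
  exact (integrable_const _).sub (h.div_const _)

lemma integral_log_gaussianPDFReal [IsProbabilityMeasure q] (hq : MemLp id 2 q)
    (m : ℝ) {s : ℝ≥0} (hs : 0 < s) :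
    ∫ x, Real.log (gaussianPDFReal m s x) ∂q = -(Real.log (2 * Real.pi) + Real.log s) / 2
      - (variance id q + (∫ x, x ∂q - m) ^ 2) / (2 * s) := by
  have h : Integrable (fun x => (x - m) ^ 2) q := (hq.sub (memLp_const m)).integrable_sq
  have h1 : Integrable (fun x : ℝ => x) q := hq.integrable one_le_two
  have h2 : ∫ x, (x - m) ^ 2 ∂q = variance id q + (∫ x, x ∂q - m) ^ 2 := by
    have hX := variance_eq_sub (hq.sub (memLp_const m))
    have hV : variance (id - fun _ => m) q = variance id q :=
      variance_sub_const hq.aestronglyMeasurable m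
    rw [hV] at hX
    simp only [Pi.pow_apply, Pi.sub_apply, id] at hX
    rw [integral_sub h1 (integrable_const m)] at hX
    simp at hX
    change ∫ x, (x - m) ^ 2 ∂q = _
    linarith
  simp_rw [log_gaussianPDFReal m hs]
  rw [integral_sub (integrable_const _) (h.div_const _), integral_div (2 * (s : ℝ)), h2]
  simp

/-- The Gaussian log-density is `q`-integrable, so finiteness does not depend on `m` or `s`. -/
lemma klDiv_gaussianReal_ne_top_iff [IsProbabilityMeasure q] (hq : MemLp id 2 q)
    (m : ℝ) {s : ℝ≥0} (hs : 0 < s) :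
    klDiv q (gaussianReal m s) ≠ ∞ ↔ q ≪ volume ∧ Integrable (llr q volume) q := by
  have hi := integrable_log_gaussianPDFReal hq m hs
  rw [klDiv_ne_top_iff]
  constructor
  · rintro ⟨hac, hint⟩
    have hqv := hac.trans (gaussianReal_absolutelyContinuous m hs.ne')
    refine ⟨hqv, ?_⟩
    rw [integrable_congr (llr_gaussianReal_ae_eq hqv m hs)] at hint
    exact (hint.add hi).congr (ae_of_all _ fun x => sub_add_cancel _ _)
  · rintro ⟨hqv, hint⟩
    refine ⟨hqv.trans (gaussianReal_absolutelyContinuous' m hs.ne'), ?_⟩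
    rw [integrable_congr (llr_gaussianReal_ae_eq hqv m hs)]
    exact hint.sub hi

lemma toReal_klDiv_gaussianReal [IsProbabilityMeasure q] (hq : MemLp id 2 q)
    (hqv : q ≪ volume) (hint : Integrable (llr q volume) q) (m : ℝ) {s : ℝ≥0} (hs : 0 < s) :
    (klDiv q (gaussianReal m s)).toReal = ∫ x, llr q volume x ∂q
      + (Real.log (2 * Real.pi) + Real.log s) / 2
      + (variance id q + (∫ x, x ∂q - m) ^ 2) / (2 * s) := by
  rw [toReal_klDiv_of_measure_eq (hqv.trans (gaussianReal_absolutelyContinuous' m hs.ne'))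
    (by simp), integral_congr_ae (llr_gaussianReal_ae_eq hqv m hs),
    integral_sub hint (integrable_log_gaussianPDFReal hq m hs),
    integral_log_gaussianPDFReal hq m hs]
  ring

/-- The moment-matching Gaussian is the unique minimiser of `KL(q ‖ ·)`. -/
lemma isEPProjection_iff [IsProbabilityMeasure q] (hq : MemLp id 2 q) (hv : 0 < variance id q)
    (hfin : ∃ (m : ℝ) (s : ℝ≥0), 0 < s ∧ klDiv q (gaussianReal m s) ≠ ∞) (m : ℝ) (s : ℝ≥0) :
    IsEPProjection q m s ↔ m = ∫ x, x ∂q ∧ (s : ℝ) = variance id q := by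
  obtain ⟨m₀, s₀, hs₀, h₀⟩ := hfin
  obtain ⟨hqv, hint⟩ := (klDiv_gaussianReal_ne_top_iff hq m₀ hs₀).1 h₀
  have hne : ∀ (m : ℝ) {s : ℝ≥0}, 0 < s → klDiv q (gaussianReal m s) ≠ ∞ := fun m s hs =>
    (klDiv_gaussianReal_ne_top_iff hq m hs).2 ⟨hqv, hint⟩
  set V := variance id q
  have hle : ∀ (m m' : ℝ) {s s' : ℝ≥0}, 0 < s → 0 < s' →
      (klDiv q (gaussianReal m s) ≤ klDiv q (gaussianReal m' s') ↔
        Real.log s / 2 + (V + (∫ x, x ∂q - m) ^ 2) / (2 * s)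
          ≤ Real.log s' / 2 + (V + (∫ x, x ∂q - m') ^ 2) / (2 * s')) :=
    fun m m' s s' hs hs' => by
      rw [← ENNReal.toReal_le_toReal (hne m hs) (hne m' hs'),
        toReal_klDiv_gaussianReal hq hqv hint m hs, toReal_klDiv_gaussianReal hq hqv hint m' hs']
      constructor <;> intro h <;> linarith
  have hlog : ∀ {s : ℝ}, 0 < s → Real.log V - Real.log s = Real.log (V / s) := fun hs =>
    (Real.log_div hv.ne' hs.ne').symm
  have hVV : V / (2 * V) = 1 / 2 := by field_simp
  have hsplit : ∀ a s : ℝ, (V + a) / (2 * s) = V / s / 2 + a / (2 * s) := fun a s => by ring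
  constructor
  · rintro ⟨hs, -, hmin⟩
    have hsR : (0 : ℝ) < s := by exact_mod_cast hs
    have hV₀ : 0 < V.toNNReal := Real.toNNReal_pos.2 hv
    have h := (hle m (∫ x, x ∂q) hs hV₀).1 (hmin _ _ hV₀)
    rw [Real.coe_toNNReal _ hv.le, sub_self, zero_pow two_ne_zero, add_zero, hVV, hsplit] at h
    have ha : 0 ≤ (∫ x, x ∂q - m) ^ 2 / (2 * s) := by positivity
    have hl := hlog hsR
    have hpos : 0 < V / s := by positivity
    -- Minimality reads `V / s - 1 + 2a ≤ log (V / s)`, with `a ≥ 0` the mean term in `ha`;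
    -- strictness of `log x < x - 1` off `1` forces equality.
    have heq : V / s = 1 := by
      by_contra hne1
      have := Real.log_lt_sub_one_of_pos hpos hne1
      linarith
    rw [heq, Real.log_one] at hl
    have ha0 : (∫ x, x ∂q - m) ^ 2 / (2 * s) = 0 := by
      rw [heq] at h
      linarith
    have hsq : (∫ x, x ∂q - m) ^ 2 = 0 := by
      rcases div_eq_zero_iff.1 ha0 with h | h
      · exact h
      · linarith
    exact ⟨(sub_eq_zero.1 (pow_eq_zero_iff two_ne_zero |>.1 hsq)).symm,
      ((div_eq_one_iff_eq hsR.ne').1 heq).symm⟩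
  · rintro ⟨rfl, hs⟩
    have hs0 : 0 < s := by rw [← NNReal.coe_pos, hs]; exact hv
    refine ⟨hs0, hne _ hs0, fun m' s' hs' => (hle _ _ hs0 hs').2 ?_⟩
    have hsR : (0 : ℝ) < s' := by exact_mod_cast hs'
    rw [hs, sub_self, zero_pow two_ne_zero, add_zero, hVV, hsplit]
    have ha : 0 ≤ (∫ x, x ∂q - m') ^ 2 / (2 * s') := by positivity
    have hpos : 0 < V / s' := by positivity
    have := Real.log_le_sub_one_of_pos hpos
    have hl := hlog hsR
    linarith

end KullbackLeibler

/-! ### The tilted distribution and the main theorem -/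

lemma isProbabilityMeasure_tiltedDistribution {μ : ℝ} {v : ℝ≥0} {ℓ : ℝ → ℝ} (hℓ0 : ∀ f, 0 ≤ ℓ f)
    (hℓint : Integrable ℓ (gaussianReal μ v)) (hℓpos : 0 < ∫ f, ℓ f ∂(gaussianReal μ v)) :
    IsProbabilityMeasure (tiltedDistribution μ v ℓ) := by
  refine ⟨?_⟩
  rw [tiltedDistribution, withDensity_apply _ MeasurableSet.univ, Measure.restrict_univ,
    ← ofReal_integral_eq_lintegral_ofReal (hℓint.div_const _)
      (ae_of_all _ fun f => div_nonneg (hℓ0 f) hℓpos.le), integral_div, div_self hℓpos.ne',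
    ENNReal.ofReal_one]

/-- Zero variance would concentrate `q` on its mean, a Lebesgue-null point. -/
lemma variance_id_pos_of_absolutelyContinuous {q : Measure ℝ} [IsProbabilityMeasure q]
    (hq : MemLp id 2 q) (hqv : q ≪ volume) : 0 < variance id q := by
  refine lt_of_le_of_ne (variance_nonneg _ _) fun h => ?_
  have h0 : (fun x : ℝ => (x - ∫ y, y ∂q) ^ 2) =ᵐ[q] 0 := by
    rw [variance_eq_integral aemeasurable_id] at h
    exact (integral_eq_zero_iff_of_nonneg (fun x => sq_nonneg _)
      (hq.sub (memLp_const _)).integrable_sq).1 h.symm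
  have h1 : ∀ᵐ x ∂q, x ≠ ∫ y, y ∂q := hqv.ae_le (Measure.ae_ne volume _)
  have h2 : ∀ᵐ x ∂q, False := by
    filter_upwards [h0, h1] with x hx hx'
    exact hx' (sub_eq_zero.1 (pow_eq_zero_iff two_ne_zero |>.1 hx))
  exact absurd h2.exists (by simp)

theorem theorem2 (μ : ℝ) (v : ℝ≥0) (hv : 0 < v) (ℓ : ℝ → ℝ) (hℓ : Measurable ℓ)
    (hℓ0 : ∀ f, 0 ≤ ℓ f) (hℓint : Integrable ℓ (gaussianReal μ v))
    (hℓpos : 0 < ∫ f, ℓ f ∂(gaussianReal μ v))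
    (q : Measure ℝ) (hq : q = tiltedDistribution μ v ℓ)
    (hq2 : Integrable (fun f : ℝ => f ^ 2) q) :
    -- the QP Gaussian exists and is unique
    (∃! p : ℝ × ℝ≥0, IsQPProjection q p.1 p.2) ∧
    -- if some Gaussian has finite KL divergence, the EP Gaussian exists, is unique, and is the
    -- Gaussian with the mean and the variance of `q`
    ((∃ (m : ℝ) (s : ℝ≥0), 0 < s ∧ klDiv q (gaussianReal m s) ≠ ∞) →
      ∀ (m : ℝ) (s : ℝ≥0),
        IsEPProjection q m s ↔ m = ∫ f, f ∂q ∧ (s : ℝ) = variance id q) ∧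
    -- comparison of the QP variance with the variance of `q`
    (∀ (m : ℝ) (s : ℝ≥0), IsQPProjection q m s →
      (s : ℝ) ≤ variance id q ∧
      wasserstein2Sq q (gaussianReal m s) = ENNReal.ofReal (variance id q - s) ∧
      ((s : ℝ) = variance id q ↔ IsGaussianLaw q)) ∧
    -- comparison of the QP variance with the EP variance
    (∀ (mQP mEP : ℝ) (sQP sEP : ℝ≥0), IsQPProjection q mQP sQP → IsEPProjection q mEP sEP →
      sQP ≤ sEP ∧
      wasserstein2Sq q (gaussianReal mQP sQP) = ENNReal.ofReal ((sEP : ℝ) - sQP) ∧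
      (sQP = sEP ↔ IsGaussianLaw q)) := by
  have : IsProbabilityMeasure q := by
    rw [hq]
    exact isProbabilityMeasure_tiltedDistribution hℓ0 hℓint hℓpos
  have hqm : MemLp id 2 q := (memLp_two_iff_integrable_sq aestronglyMeasurable_id).2 hq2
  have hqv : q ≪ volume := by
    rw [hq]
    exact (withDensity_absolutelyContinuous _ _).trans (gaussianReal_absolutelyContinuous μ hv.ne')
  have hvar := variance_id_pos_of_absolutelyContinuous hqm hqv
  have hle : ∀ {m : ℝ} {s : ℝ≥0}, IsQPProjection q m s → (s : ℝ) ≤ variance id q := fun h => by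
    rw [((isQPProjection_iff hqm hvar _ _).1 h).2]
    exact gaussianCorrelation_sq_le_variance hqm hvar
  refine ⟨⟨(∫ x, x ∂q, (gaussianCorrelation q ^ 2).toNNReal), ?_, ?_⟩,
    isEPProjection_iff hqm hvar, fun m s h => ⟨hle h, wasserstein2Sq_of_isQPProjection hqm hvar h,
      isQPProjection_variance_eq_iff hqm hvar h⟩, fun mQP mEP sQP sEP hQP hEP => ?_⟩
  · exact (isQPProjection_iff hqm hvar _ _).2 ⟨rfl, Real.coe_toNNReal _ (sq_nonneg _)⟩
  · rintro ⟨m, s⟩ h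
    obtain ⟨hm, hs⟩ := (isQPProjection_iff hqm hvar _ _).1 h
    refine Prod.ext hm (NNReal.coe_injective ?_)
    rw [Real.coe_toNNReal _ (sq_nonneg _)]
    exact hs
  -- An EP projection has finite divergence by definition, so it supplies the finiteness hypothesis
  -- itself.
  · have hs := ((isEPProjection_iff hqm hvar ⟨mEP, sEP, hEP.1, hEP.2.1⟩ mEP sEP).1 hEP).2
    refine ⟨?_, ?_, ?_⟩
    · rw [← NNReal.coe_le_coe, hs]
      exact hle hQP
    · rw [hs]
      exact wasserstein2Sq_of_isQPProjection hqm hvar hQP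
    · rw [← isQPProjection_variance_eq_iff hqm hvar hQP, ← hs, NNReal.coe_inj]
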